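/- Let $(\mathbb{T},+)$ be a finitely generated torsion-free abelian group. For a finitely supported probability distribution $p$, let $H(p)=-\sum_a p(a)\log p(a)$ denote its Shannon entropy (with $0\log 0=0$), and write $H(X)$ for the entropy of the distribution of a random variable $X$. For finitely supported distributions $P_X,P_Y$ on $\mathbb{T}$, let $\Pi(P_X,P_Y)$ be the set of all couplings of $P_X$ and $P_Y$, i.e. of all joint distributions on $\mathbb{T}\times\mathbb{T}$ with marginals $P_X$ and $P_Y$, and define the (maximal) entropic Ruzsa distance $$d_{HR}(X,Y):=\max_{P_{XY}\in\Pi(P_X,P_Y)}H(X-Y)-\tfrac12H(X)-\tfrac12H(Y).$$ Then for any distributions $P_X,P_Y,P_Z$ with finite support on $\mathbb{T}$, the maxima over couplings below exist, and $$d_{HR}(X,Z)\le d_{HR}(X,Y)+d_{HR}(Y,Z),$$ or equivalently $$H(Y)+\max_{\Pi(P_X,P_Z)}H(X-Z)\le\max_{\Pi(P_X,P_Y)}H(X-Y)+\max_{\Pi(P_Y,P_Z)}H(Y-Z).$$ -/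

import Mathlib

noncomputable section

namespace EntropicRuzsa

/-- The Shannon entropy `H(p) = -∑ₐ p(a) log p(a)` of a discrete distribution, in nats.
`Real.negMulLog x = -x * log x`, which is `0` at `x = 0`. For a distribution of finite support,
the sum has only finitely many non-zero terms. -/
def entropy {α : Type*} (p : PMF α) : ℝ :=
  ∑' a, Real.negMulLog (p a).toReal

/-- The set `Π(p, q)` of all couplings of `p` and `q`: the joint distributions whose first marginal
is `p` and whose second marginal is `q`. -/
def couplings {α β : Type*} (p : PMF α) (q : PMF β) : Set (PMF (α × β)) :=
  {π | π.map Prod.fst = p ∧ π.map Prod.snd = q}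

/-- The set of all values of `H(X - Y)`, as the joint distribution of `(X, Y)` ranges over the
couplings of `p` and `q`. -/
def diffEntropies {G : Type*} [AddCommGroup G] (p q : PMF G) : Set ℝ :=
  (fun π : PMF (G × G) => entropy (π.map fun z => z.1 - z.2)) '' couplings p q

/-- The maximum of `H(X - Y)` over all couplings of `p` and `q` (as a supremum; that it is attained
for distributions of finite support is part of the theorem). -/
def maxDiffEntropy {G : Type*} [AddCommGroup G] (p q : PMF G) : ℝ :=
  sSup (diffEntropies p q)

/-- The (maximal) entropic Ruzsa distance of two distributions `p`, `q`:
`max H(X - Y) - H(X) / 2 - H(Y) / 2`, the maximum taken over all couplings of `p` and `q`. -/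
def entropicRuzsaDist {G : Type*} [AddCommGroup G] (p q : PMF G) : ℝ :=
  maxDiffEntropy p q - 1 / 2 * entropy p - 1 / 2 * entropy q

end EntropicRuzsa

end

/-! Take a coupling of (X, Z) maximizing H(X-Z) and let Y be independent of the pair; then (X, Y)
and (Y, Z) are admissible couplings. With a, b, d, q the laws of X-Y, Y-Z, X-Z, Y, the quantity H(Y)
+ H(X-Z) - H(X-Y) - H(Y-Z) is the mean of log(a b / (q d)). By log t ≤ t - 1 it is at most 0 once
the mean of a b / (q d) is at most 1 (`tsum_mul_div_map_sub_le_one`). Independence cancels q;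
summing over y then gives the convolution (a * b)(x-z), of total mass 1. The maxima exist by
compactness and continuity. -/

open scoped ENNReal Classical in
/-- A finite-sum formula for the push-forward of a finitely supported distribution. -/
theorem PMF.map_apply_eq_sum_filter {α β : Type*} (μ : PMF α) (f : α → β) (F : Finset α)
    (hF : ∀ a, a ∉ F → μ a = 0) (b : β) :
    (μ.map f) b = ∑ a ∈ F.filter (fun a => f a = b), μ a := by
  rw [PMF.map_apply, tsum_eq_sum (s := F), Finset.sum_filter]
  · exact Finset.sum_congr rfl fun a _ => by simp only [eq_comm]
  · intro a ha
    simp [hF a ha]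

open scoped ENNReal in
theorem PMF.tsum_map_mul {α β : Type*} (μ : PMF α) (f : α → β) (g : β → ℝ≥0∞) :
    ∑' b, (μ.map f) b * g b = ∑' a, μ a * g (f a) := by
  classical
  simp only [PMF.map_apply, ← ENNReal.tsum_mul_right]
  rw [ENNReal.tsum_comm]
  refine tsum_congr fun a => ?_
  rw [tsum_eq_single (f a)]
  · simp
  · intro b hb
    simp [hb]

theorem PMF.apply_le_map_apply {α β : Type*} (μ : PMF α) (f : α → β) (a : α) :
    μ a ≤ (μ.map f) (f a) := by
  classical
  rw [PMF.map_apply]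
  refine le_trans ?_ (ENNReal.le_tsum a)
  simp

namespace EntropicRuzsa

open scoped ENNReal

-- The index sets depend on `F` but not on `μ`, so entropy becomes a fixed function of finitely many
-- masses, whose continuity can be checked.
open scoped Classical in
theorem entropy_map_eq_sum_image {α β : Type*} (μ : PMF α) (f : α → β) (F : Finset α)
    (hF : ∀ a, a ∉ F → μ a = 0) :
    entropy (μ.map f) =
      ∑ b ∈ F.image f, Real.negMulLog (∑ a ∈ F.filter (fun a => f a = b), μ a).toReal := by
  rw [entropy, tsum_eq_sum (s := F.image f)]
  · exact Finset.sum_congr rfl fun b _ => by rw [PMF.map_apply_eq_sum_filter μ f F hF]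
  · intro b hb
    rw [PMF.map_apply_eq_sum_filter μ f F hF, Finset.filter_false_of_mem]
    · simp
    · rintro a ha rfl
      exact hb (Finset.mem_image_of_mem f ha)

/-- The entropy of `f(ω)` is the mean of `-log` of the probability of the value of `f`. -/
theorem entropy_map_eq_sum {α β : Type*} (μ : PMF α) (f : α → β) (F : Finset α)
    (hF : ∀ a, a ∉ F → μ a = 0) :
    entropy (μ.map f) = -∑ a ∈ F, (μ a).toReal * Real.log ((μ.map f) (f a)).toReal := by
  classical
  rw [entropy_map_eq_sum_image μ f F hF,
    ← Finset.sum_fiberwise_of_maps_to (g := f) (t := F.image f)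
      (fun a ha => Finset.mem_image_of_mem f ha), ← Finset.sum_neg_distrib]
  refine Finset.sum_congr rfl fun b _ => ?_
  rw [Real.negMulLog, ← PMF.map_apply_eq_sum_filter μ f F hF b]
  nth_rewrite 1 [PMF.map_apply_eq_sum_filter μ f F hF b]
  rw [ENNReal.toReal_sum fun a _ => μ.apply_ne_top a, neg_mul, Finset.sum_mul]
  congr 1
  refine Finset.sum_congr rfl fun a ha => ?_
  rw [(Finset.mem_filter.1 ha).2]

/-- The independent coupling of two distributions. -/
noncomputable def indep {α β : Type*} (p : PMF α) (q : PMF β) : PMF (α × β) :=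
  p.bind fun a => q.map fun b => (a, b)

theorem indep_apply {α β : Type*} (p : PMF α) (q : PMF β) (z : α × β) :
    indep p q z = p z.1 * q z.2 := by
  classical
  obtain ⟨a, b⟩ := z
  rw [indep, PMF.bind_apply, tsum_eq_single a]
  · rw [PMF.map_apply, tsum_eq_single b]
    · simp
    · intro b' hb'
      simp [hb'.symm]
  · intro a' ha'
    rw [PMF.map_apply]
    simp [ha'.symm]

theorem indep_map_fst {α β : Type*} (p : PMF α) (q : PMF β) : (indep p q).map Prod.fst = p := by
  rw [indep, PMF.map_bind]
  simp only [PMF.map_comp, Function.comp_def]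
  change (p.bind fun a => q.map (Function.const β a)) = p
  simp only [PMF.map_const, PMF.bind_pure]

theorem indep_map_snd {α β : Type*} (p : PMF α) (q : PMF β) : (indep p q).map Prod.snd = q := by
  rw [indep, PMF.map_bind]
  simp only [PMF.map_comp, Function.comp_def]
  change (p.bind fun _ => q.map id) = q
  simp [PMF.map_id]

theorem indep_mem_couplings {α β : Type*} (p : PMF α) (q : PMF β) :
    indep p q ∈ couplings p q :=
  ⟨indep_map_fst p q, indep_map_snd p q⟩

theorem eq_zero_of_mem_couplings {α β : Type*} {p : PMF α} {q : PMF β} {π : PMF (α × β)}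
    (hπ : π ∈ couplings p q) {z : α × β} (hz : p z.1 = 0 ∨ q z.2 = 0) : π z = 0 := by
  rcases hz with hz | hz
  · exact le_antisymm (hz ▸ hπ.1 ▸ π.apply_le_map_apply Prod.fst z) zero_le
  · exact le_antisymm (hz ▸ hπ.2 ▸ π.apply_le_map_apply Prod.snd z) zero_le

theorem exists_finset_forall_couplings {α β : Type*} {p : PMF α} {q : PMF β}
    (hp : p.support.Finite) (hq : q.support.Finite) :
    ∃ F : Finset (α × β), ∀ π ∈ couplings p q, ∀ z, z ∉ F → π z = 0 := by
  refine ⟨hp.toFinset ×ˢ hq.toFinset, fun π hπ z hz => eq_zero_of_mem_couplings hπ ?_⟩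
  simp only [Finset.mem_product, Set.Finite.mem_toFinset, PMF.mem_support_iff] at hz
  tauto

/-- Couplings of finitely supported distributions form a compact set of mass functions. -/
theorem isCompact_couplings {α β : Type*} {p : PMF α} {q : PMF β}
    (hp : p.support.Finite) (hq : q.support.Finite) :
    IsCompact ((fun π : PMF (α × β) => (π : α × β → ℝ≥0∞)) '' couplings p q) := by
  classical
  obtain ⟨F, hF⟩ := exists_finset_forall_couplings hp hq
  have key : (fun π : PMF (α × β) => (π : α × β → ℝ≥0∞)) '' couplings p q =
      {v | ∀ z, z ∉ F → v z = 0} ∩ {v | ∑ z ∈ F, v z = 1} ∩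
        {v | ∀ a, ∑ z ∈ F.filter (fun z => z.1 = a), v z = p a} ∩
        {v | ∀ b, ∑ z ∈ F.filter (fun z => z.2 = b), v z = q b} := by
    ext v
    constructor
    · rintro ⟨π, hπ, rfl⟩
      refine ⟨⟨⟨hF π hπ, ?_⟩, fun a => ?_⟩, fun b => ?_⟩
      · change ∑ z ∈ F, π z = 1
        exact (tsum_eq_sum (hF π hπ)).symm.trans π.tsum_coe
      · change ∑ z ∈ F.filter (fun z => z.1 = a), π z = p a
        rw [← PMF.map_apply_eq_sum_filter π Prod.fst F (hF π hπ), hπ.1]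
      · change ∑ z ∈ F.filter (fun z => z.2 = b), π z = q b
        rw [← PMF.map_apply_eq_sum_filter π Prod.snd F (hF π hπ), hπ.2]
    · rintro ⟨⟨⟨h0, h1⟩, ha⟩, hb⟩
      refine ⟨PMF.ofFinset v F h1 h0, ⟨PMF.ext fun a => ?_, PMF.ext fun b => ?_⟩, rfl⟩
      · rw [PMF.map_apply_eq_sum_filter _ Prod.fst F (fun z hz => h0 z hz)]
        exact ha a
      · rw [PMF.map_apply_eq_sum_filter _ Prod.snd F (fun z hz => h0 z hz)]
        exact hb b
  rw [key]
  have hs (s : Finset (α × β)) (c : ℝ≥0∞) :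
      IsClosed {v : α × β → ℝ≥0∞ | ∑ z ∈ s, v z = c} :=
    isClosed_eq (continuous_finsetSum _ fun z _ => continuous_apply z) continuous_const
  -- Closedness suffices: a product of copies of the compact space `ℝ≥0∞` is compact.
  refine (((IsClosed.inter ?_ (hs _ _)).inter ?_).inter ?_).isCompact
  · simp only [Set.ofPred_forall]
    exact isClosed_iInter fun z => isClosed_iInter fun _ =>
      isClosed_eq (continuous_apply z) continuous_const
  · simp only [Set.ofPred_forall]
    exact isClosed_iInter fun a => hs _ _
  · simp only [Set.ofPred_forall]
    exact isClosed_iInter fun b => hs _ _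

/-- The set of values of `H(X - Y)` over all couplings has a greatest element. -/
theorem isGreatest_maxDiffEntropy {G : Type*} [AddCommGroup G] {p q : PMF G}
    (hp : p.support.Finite) (hq : q.support.Finite) :
    IsGreatest (diffEntropies p q) (maxDiffEntropy p q) := by
  classical
  obtain ⟨F, hF⟩ := exists_finset_forall_couplings hp hq
  let Φ : (G × G → ℝ≥0∞) → ℝ := fun v => ∑ b ∈ F.image (fun z => z.1 - z.2),
    Real.negMulLog (∑ z ∈ F.filter (fun z => z.1 - z.2 = b), v z).toReal
  have himage : diffEntropies p q =
      Φ '' ((fun π : PMF (G × G) => (π : G × G → ℝ≥0∞)) '' couplings p q) := by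
    rw [Set.image_image]
    exact Set.image_congr fun π hπ => entropy_map_eq_sum_image π _ F (hF π hπ)
  -- `toReal` is discontinuous at `∞`, so continuity is claimed only on the couplings, whose masses
  -- are finite.
  have hcont : ContinuousOn Φ
      ((fun π : PMF (G × G) => (π : G × G → ℝ≥0∞)) '' couplings p q) := by
    refine continuousOn_finsetSum _ fun b _ => Real.continuous_negMulLog.comp_continuousOn ?_
    refine ENNReal.continuousOn_toReal.comp
      (continuous_finsetSum _ fun z _ => continuous_apply z).continuousOn ?_
    rintro _ ⟨π, _, rfl⟩
    exact ENNReal.sum_ne_top.2 fun z _ => π.apply_ne_top z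
  have hcomp : IsCompact (diffEntropies p q) :=
    himage ▸ (isCompact_couplings hp hq).image_of_continuousOn hcont
  exact hcomp.isGreatest_sSup ⟨_, _, indep_mem_couplings p q, rfl⟩

/-- If `Y` is independent of `(X, Z)`, the mean of `P(X-Y) P(Y-Z) / (P(Y) P(X-Z))` is at most one:
here `a`, `b` are any two distributions in place of those of `X - Y` and `Y - Z`. -/
theorem tsum_mul_div_map_sub_le_one {G : Type*} [AddCommGroup G] (π : PMF (G × G)) (a b : PMF G) :
    ∑' ω : (G × G) × G, π ω.1 *
      (a (ω.1.1 - ω.2) * b (ω.2 - ω.1.2) / (π.map fun z => z.1 - z.2) (ω.1.1 - ω.1.2)) ≤ 1 := by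
  set d := π.map fun z => z.1 - z.2
  -- Substituting t = x - y turns the sum over y into a convolution that depends only on x - z.
  have hinner (z : G × G) : ∑' y, π z * (a (z.1 - y) * b (y - z.2) / d (z.1 - z.2)) =
      π z * ((∑' t, a t * b (z.1 - z.2 - t)) / d (z.1 - z.2)) := by
    rw [ENNReal.tsum_mul_left, ← (Equiv.subLeft z.1).tsum_eq fun t => a t * b (z.1 - z.2 - t)]
    simp only [div_eq_mul_inv, ENNReal.tsum_mul_right, Equiv.subLeft_apply]
    congr 4
    funext y
    congr 2
    abel
  rw [ENNReal.tsum_prod']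
  simp only [hinner]
  rw [← PMF.tsum_map_mul π (fun z => z.1 - z.2) fun w => (∑' t, a t * b (w - t)) / d w]
  -- Equality can fail where `d w = 0`: the left term vanishes there.
  calc ∑' w, d w * ((∑' t, a t * b (w - t)) / d w)
      ≤ ∑' w, ∑' t, a t * b (w - t) := ENNReal.tsum_le_tsum fun w => ENNReal.mul_div_le
    _ = ∑' t, a t * ∑' w, b (w - t) := by
      rw [ENNReal.tsum_comm]
      simp only [ENNReal.tsum_mul_left]
    _ = 1 := by
      have h (t : G) : ∑' w, b (w - t) = 1 := by
        exact ((Equiv.subRight t).tsum_eq fun w => b w).trans b.tsum_coe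
      simp only [h, mul_one, a.tsum_coe]

/-- The entropic Ruzsa triangle inequality for `Y` independent of the pair `(X, Z)`. -/
theorem entropy_add_entropy_sub_le {G : Type*} [AddCommGroup G] (π : PMF (G × G)) (q : PMF G)
    (hπ : π.support.Finite) (hq : q.support.Finite) :
    entropy q + entropy (π.map fun z => z.1 - z.2) ≤
      entropy ((indep π q).map fun ω => ω.1.1 - ω.2) +
        entropy ((indep π q).map fun ω => ω.2 - ω.1.2) := by
  obtain ⟨F, hF⟩ := exists_finset_forall_couplings hπ hq
  replace hF := hF _ (indep_mem_couplings π q)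
  set μ := indep π q with hμ
  set a := μ.map fun ω => ω.1.1 - ω.2 with ha
  set b := μ.map fun ω => ω.2 - ω.1.2 with hb
  set d := π.map fun z => z.1 - z.2 with hd
  have hd' : μ.map (fun ω => ω.1.1 - ω.1.2) = d := by
    rw [hd, ← indep_map_fst π q, PMF.map_comp]
    rfl
  have hHq : entropy q = _ := indep_map_snd π q ▸ entropy_map_eq_sum μ Prod.snd F hF
  have hHd : entropy d = _ := hd' ▸ entropy_map_eq_sum μ (fun ω => ω.1.1 - ω.1.2) F hF
  have hHa : entropy a = _ := entropy_map_eq_sum μ (fun ω => ω.1.1 - ω.2) F hF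
  have hHb : entropy b = _ := entropy_map_eq_sum μ (fun ω => ω.2 - ω.1.2) F hF
  rw [hHq, hHd, hHa, hHb, ← ha, ← hb, ← sub_nonpos]
  have hle : ∑ ω ∈ F, π ω.1 *
      (a (ω.1.1 - ω.2) * b (ω.2 - ω.1.2) / d (ω.1.1 - ω.1.2)) ≤ 1 :=
    (ENNReal.sum_le_tsum F).trans (tsum_mul_div_map_sub_le_one π a b)
  have hone : ∑ ω ∈ F, (μ ω).toReal = 1 := by
    rw [← ENNReal.toReal_sum fun ω _ => μ.apply_ne_top ω,
      (tsum_eq_sum hF).symm.trans μ.tsum_coe, ENNReal.toReal_one]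
  have hle' := ENNReal.toReal_mono ENNReal.one_ne_top hle
  rw [ENNReal.toReal_one, ENNReal.toReal_sum
    fun ω hω => ((ENNReal.sum_lt_top.1 (hle.trans_lt ENNReal.one_lt_top)) ω hω).ne] at hle'
  -- Termwise μ log t ≤ μ t - μ with t = a b / (q d); in `g` the factor q of μ is already cancelled,
  -- so atoms with μ = 0 contribute a nonnegative term on the right.
  refine le_trans (le_of_eq_of_le ?_ (Finset.sum_le_sum (s := F)
    (f := fun ω => (μ ω).toReal * (Real.log (a (ω.1.1 - ω.2)).toReal +
      Real.log (b (ω.2 - ω.1.2)).toReal - Real.log (q ω.2).toReal -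
      Real.log (d (ω.1.1 - ω.1.2)).toReal))
    (g := fun ω => (π ω.1 *
      (a (ω.1.1 - ω.2) * b (ω.2 - ω.1.2) / d (ω.1.1 - ω.1.2))).toReal - (μ ω).toReal)
    fun ω _ => ?_)) ?_
  · simp only [mul_sub, mul_add, Finset.sum_sub_distrib, Finset.sum_add_distrib]
    ring
  · have hμω : μ ω = π ω.1 * q ω.2 := indep_apply π q ω
    rcases eq_or_ne (μ ω) 0 with h0 | h0
    · simp only [h0, ENNReal.toReal_zero, zero_mul, sub_zero, ENNReal.toReal_nonneg]
    have hpos {p : PMF G} {g : G} (h : μ ω ≤ p g) : 0 < (p g).toReal :=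
      ENNReal.toReal_pos ((pos_iff_ne_zero.2 h0).trans_le h).ne' (p.apply_ne_top g)
    have hapos := hpos (μ.apply_le_map_apply (fun ω => ω.1.1 - ω.2) ω)
    have hbpos := hpos (μ.apply_le_map_apply (fun ω => ω.2 - ω.1.2) ω)
    have hdpos := hpos (hd' ▸ μ.apply_le_map_apply (fun ω => ω.1.1 - ω.1.2) ω)
    have hqpos := hpos (indep_map_snd π q ▸ μ.apply_le_map_apply Prod.snd ω)
    rw [← ha] at hapos
    rw [← hb] at hbpos
    rw [hμω]
    simp only [ENNReal.toReal_mul, ENNReal.toReal_div]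
    rw [← Real.log_mul hapos.ne' hbpos.ne', ← Real.log_div (by positivity) hqpos.ne',
      ← Real.log_div (by positivity) hdpos.ne']
    refine (mul_le_mul_of_nonneg_left (Real.log_le_sub_one_of_pos (by positivity))
      (by positivity)).trans (le_of_eq ?_)
    field_simp
  · rw [Finset.sum_sub_distrib, hone]
    linarith

theorem entropy_add_maxDiffEntropy_le {G : Type*} [AddCommGroup G] {p q r : PMF G}
    (hp : p.support.Finite) (hq : q.support.Finite) (hr : r.support.Finite) :
    entropy q + maxDiffEntropy p r ≤ maxDiffEntropy p q + maxDiffEntropy q r := by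
  obtain ⟨π, hπ, hmax⟩ := (isGreatest_maxDiffEntropy hp hr).1
  obtain ⟨F, hF⟩ := exists_finset_forall_couplings hp hr
  have hπfin : π.support.Finite := F.finite_toSet.subset fun z hz => by
    by_contra h
    exact (PMF.mem_support_iff _ _).1 hz (hF π hπ z h)
  rw [← hmax]
  refine (entropy_add_entropy_sub_le π q hπfin hq).trans (add_le_add ?_ ?_)
  · refine (isGreatest_maxDiffEntropy hp hq).2
      ⟨(indep π q).map fun ω => (ω.1.1, ω.2), ⟨?_, ?_⟩, ?_⟩
    · rw [PMF.map_comp, ← hπ.1, ← indep_map_fst π q, PMF.map_comp, indep_map_fst]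
      rfl
    · rw [PMF.map_comp]
      exact indep_map_snd π q
    · simp only [PMF.map_comp, Function.comp_def]
  · refine (isGreatest_maxDiffEntropy hq hr).2
      ⟨(indep π q).map fun ω => (ω.2, ω.1.2), ⟨?_, ?_⟩, ?_⟩
    · rw [PMF.map_comp]
      exact indep_map_snd π q
    · rw [PMF.map_comp, ← hπ.2, ← indep_map_fst π q, PMF.map_comp, indep_map_fst]
      rfl
    · simp only [PMF.map_comp, Function.comp_def]

end EntropicRuzsa


theorem mainTheorem8 {T : Type*} [AddCommGroup T] [AddGroup.FG T] [IsAddTorsionFree T]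
    (pX pY pZ : PMF T)
    (hX : pX.support.Finite) (hY : pY.support.Finite) (hZ : pZ.support.Finite) :
    -- the three maxima over couplings exist
    (IsGreatest (EntropicRuzsa.diffEntropies pX pZ) (EntropicRuzsa.maxDiffEntropy pX pZ) ∧
      IsGreatest (EntropicRuzsa.diffEntropies pX pY) (EntropicRuzsa.maxDiffEntropy pX pY) ∧
      IsGreatest (EntropicRuzsa.diffEntropies pY pZ) (EntropicRuzsa.maxDiffEntropy pY pZ)) ∧
    -- the triangle inequality
    EntropicRuzsa.entropicRuzsaDist pX pZ ≤
      EntropicRuzsa.entropicRuzsaDist pX pY + EntropicRuzsa.entropicRuzsaDist pY pZ ∧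
    -- its equivalent form
    EntropicRuzsa.entropy pY + EntropicRuzsa.maxDiffEntropy pX pZ ≤
      EntropicRuzsa.maxDiffEntropy pX pY + EntropicRuzsa.maxDiffEntropy pY pZ := by

  have h := EntropicRuzsa.entropy_add_maxDiffEntropy_le hX hY hZ
  refine ⟨⟨EntropicRuzsa.isGreatest_maxDiffEntropy hX hZ,
    EntropicRuzsa.isGreatest_maxDiffEntropy hX hY,
    EntropicRuzsa.isGreatest_maxDiffEntropy hY hZ⟩, ?_, h⟩
  simp only [EntropicRuzsa.entropicRuzsaDist]
  linarith
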